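/- Consider a downlink with an $M$-antenna base station and $M$ clusters of $K\ge 2$ users with $N$ antennas each, where $N=M=2$. Let $\mathbf H_{i,j}$ be the $N\times M$ channel matrix of the $j$-th user of cluster $i$; all entries of all these matrices are i.i.d. standard complex Gaussian $\mathcal{CN}(0,1)$ (Rayleigh fading). The precoding matrix is the identity. The detection vector of a user of cluster $i$ with channel matrix $\mathbf H$ is $\mathbf v=\mathbf U\mathbf z$, where the $N-M+1$ orthonormal columns of $\mathbf U$ are left singular vectors, for the singular value $0$, of $\mathbf H$ with its $i$-th column $\mathbf h$ deleted, and $\mathbf z=\mathbf U^H\mathbf h/|\mathbf U^H\mathbf h|$. The effective channel gain of the user is $|\mathbf v^H\mathbf h|^2$, and the users of each cluster are numbered in decreasing order of this gain; $\mathbf v_{i,j}$ and $\mathbf h_{i,j}$ (the $i$-th column of the user's channel matrix) refer to the $j$-th ordered user of cluster $i$, and $x_{i,j}=|\mathbf v_{i,j}^H\mathbf h_{i,j}|^2$. Let $\rho>0$ be the transmit SNR and, for $n<k$, let the $n$-th and the $k$-th ordered user of each cluster be paired, with power allocation coefficients $\alpha_n>0$ and $\alpha_k$ (the same in all clusters),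 $\alpha_n^2+\alpha_k^2=1$. Put $$SNR_{i,k}=\frac{x_{i,k}\alpha_k^2}{x_{i,k}\alpha_n^2+|\mathbf v_{i,k}|^2/\rho},\qquad SNR_{i,n}=\rho\,\frac{x_{i,n}\alpha_n^2}{|\mathbf v_{i,n}|^2},$$ and define the sum-rate gap between MIMO-NOMA and MIMO-OMA by $$\Delta=\sum_{i=1}^{M}\bigl[\log(1+SNR_{i,k})+\log(1+SNR_{i,n})\bigr]-\frac12\sum_{i=1}^{M}\bigl[\log(1+\rho x_{i,k})+\log(1+\rho x_{i,n})\bigr],$$ where $\log$ is the logarithm to base $2$. For $x<0$ let $\mathrm{Ei}(x)=\int_{-\infty}^{x}\frac{e^t}{t}\,dt$, and for $m\geq 1$ and $\phi>0$ write $$S_m(\phi)=\sum_{l=1}^{m}\binom{m}{l}(-1)^l e^{l/\phi}\,\mathrm{Ei}\!\left(-\frac{l}{\phi}\right).$$ Case I ($n=1$, $k=K$). For every $\rho>0$ the gap $\Delta$ is integrable and $$\mathcal E\{\Delta\}=-\log(e)\,e^{K/\rho}\,\mathrm{Ei}\!\left(-\frac K\rho\right)+\frac{2}{\ln 2}S_K(\rho\alpha_1^2)+2\log(e)\,e^{K/(\rho\alpha_1^2)}\,\mathrm{Ei}\!\left(-\frac{K}{\rho\alpha_1^2}\right)-\frac1{\ln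 2}S_K(\rho).$$ As $\rho\to\infty$ (with the coefficients fixed), $$\mathcal E\{\Delta\}\to\log K+\sum_{l=1}^{K}\binom Kl(-1)^l\log l .$$ Case II ($n=1$, $k=2$). For every $\rho>0$ the gap $\Delta$ is integrable and $$\mathcal E\{\Delta\}=\frac1{\ln2}\bigl(K S_{K-1}(\rho)-(K-1)S_K(\rho)\bigr)+\frac2{\ln2}S_K(\rho\alpha_1^2)-\frac2{\ln2}\bigl(K S_{K-1}(\rho\alpha_1^2)-(K-1)S_K(\rho\alpha_1^2)\bigr)-\frac1{\ln2}S_K(\rho).$$ As $\rho\to\infty$ (with the coefficients fixed), $$\mathcal E\{\Delta\}\to K\left(-\sum_{p=1}^{K-1}\binom{K-1}{p}(-1)^p\log p+\sum_{l=1}^{K}\binom Kl(-1)^l\log l\right).$$ -/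

import Mathlib

open MeasureTheory ProbabilityTheory Filter Topology
open scoped Matrix

namespace MimoNoma

/-- The standard circularly symmetric complex Gaussian law: independent real and imaginary parts,
each centred Gaussian with variance `1/2`, so that the total variance is one. -/
noncomputable def stdComplexGaussian : Measure ℂ :=
  ((gaussianReal 0 (1 / 2)).prod (gaussianReal 0 (1 / 2))).map Complex.measurableEquivRealProd.symm

/-- The exponential integral `Ei(x) = ∫_{-∞}^x e^t / t dt` on the negative half-line, the only
range where it is used (for `x ≥ 0` the integral diverges and the value is not meaningful). -/
noncomputable def Ei (x : ℝ) : ℝ := ∫ t in Set.Iic x, Real.exp t / t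

/-- Rayleigh fading for `M` clusters of `K` users with `N` receive antennas each: `G i j` is the
channel matrix from the `M` transmit antennas to the `j`-th user of the `i`-th cluster (before
ordering), and all the entries of all these matrices are i.i.d. standard complex Gaussian. -/
structure IsRayleigh {Ω : Type*} [MeasurableSpace Ω] {M K N : ℕ}
    (G : Fin M → Fin K → Ω → Matrix (Fin N) (Fin M) ℂ) (μ : Measure Ω) : Prop where
  hasLaw : ∀ i j a b, HasLaw (fun ω => G i j ω a b) stdComplexGaussian μ
  indep : iIndepFun (fun (p : Fin M × Fin K × Fin N × Fin M) (ω : Ω) =>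
    G p.1 p.2.1 ω p.2.2.1 p.2.2.2) μ

/-- The columns of `U` are `N - M + 1` orthonormal left singular vectors, for the singular value
zero, of the matrix obtained from `H` by deleting its `i`-th column. (They span the whole left null
space of that matrix whenever its `M - 1` columns are linearly independent, hence almost surely.) -/
def IsNullBasis {M N : ℕ} (i : Fin M) (H : Matrix (Fin N) (Fin M) ℂ)
    (U : Matrix (Fin N) (Fin (N - M + 1)) ℂ) : Prop :=
  Uᴴ * U = 1 ∧ ∀ m, m ≠ i → Uᴴ *ᵥ H.col m = 0

/-- Euclidean norm of a complex vector. -/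
noncomputable def vecNorm {n : ℕ} (w : Fin n → ℂ) : ℝ := ‖WithLp.toLp 2 w‖

/-- Maximal ratio combining weight `z = Uᴴ h / |Uᴴ h|`. -/
noncomputable def mrcWeight {n r : ℕ} (U : Matrix (Fin n) (Fin r) ℂ) (h : Fin n → ℂ) :
    Fin r → ℂ :=
  ((vecNorm (Uᴴ *ᵥ h) : ℝ) : ℂ)⁻¹ • (Uᴴ *ᵥ h)

/-- Detection vector `v = U z` of a user of cluster `i` with channel matrix `H`. -/
noncomputable def detVec {M N r : ℕ} (i : Fin M) (H : Matrix (Fin N) (Fin M) ℂ)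
    (U : Matrix (Fin N) (Fin r) ℂ) : Fin N → ℂ :=
  U *ᵥ mrcWeight U (H.col i)

/-- Effective channel gain `|vᴴ h|²`, where `v` is the detection vector of a user of cluster `i`
and `h` is the `i`-th column of its channel matrix (the precoding matrix is the identity). -/
noncomputable def gain {M N r : ℕ} (i : Fin M) (H : Matrix (Fin N) (Fin M) ℂ)
    (U : Matrix (Fin N) (Fin r) ℂ) : ℝ :=
  ‖star (detVec i H U) ⬝ᵥ H.col i‖ ^ 2

/-- SNR of the weaker user of a pair; `a`, `b` are the power allocation coefficients of the
stronger and of the weaker user, and `ρ` is the transmit SNR. -/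
noncomputable def snrWeak {M N r : ℕ} (ρ a b : ℝ) (i : Fin M) (H : Matrix (Fin N) (Fin M) ℂ)
    (U : Matrix (Fin N) (Fin r) ℂ) : ℝ :=
  gain i H U * b ^ 2 / (gain i H U * a ^ 2 + vecNorm (detVec i H U) ^ 2 * (1 / ρ))

/-- SNR of the stronger user of a pair, after removal of the weaker user's message. -/
noncomputable def snrStrong {M N r : ℕ} (ρ a : ℝ) (i : Fin M) (H : Matrix (Fin N) (Fin M) ℂ)
    (U : Matrix (Fin N) (Fin r) ℂ) : ℝ :=
  ρ * (gain i H U * a ^ 2 / vecNorm (detVec i H U) ^ 2)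

/-- Sum-rate gap between MIMO-NOMA and MIMO-OMA (in bits) when in every cluster the `n`-th and the
`k`-th ordered user are paired, the `n`-th one being the stronger; `H i j` and `U i j` belong to
the `j`-th ordered user of cluster `i`. -/
noncomputable def sumRateGap {M K N r : ℕ} (ρ a b : ℝ) (n k : Fin K)
    (H : Fin M → Fin K → Matrix (Fin N) (Fin M) ℂ)
    (U : Fin M → Fin K → Matrix (Fin N) (Fin r) ℂ) : ℝ :=
  (∑ i, (Real.logb 2 (1 + snrWeak ρ a b i (H i k) (U i k))
      + Real.logb 2 (1 + snrStrong ρ a i (H i n) (U i n))))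
    - 1 / 2 * ∑ i, (Real.logb 2 (1 + ρ * gain i (H i k) (U i k))
      + Real.logb 2 (1 + ρ * gain i (H i n) (U i n)))

end MimoNoma

namespace MimoNoma

/-! For `M = N = 2` the vector `U` is a unit vector orthogonal to the single interfering column, so
the gain is `|det H|²` over the squared norm of that column (`gain_eq_detRatio`). With the
interfering column fixed, this is the squared modulus of a unit-norm combination of two independent
standard complex Gaussians. By rotation invariance it is exponential with mean one (`ratio_law`),
and the gains within a cluster are i.i.d.

Since `α² + β² = 1` and the detection vector has norm one unless the gain vanishes, the gap is a
linear combination of terms `log (1 + φ x)` with `φ = ρ` or `ρα²` and `x` an ordered gain. The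
layer-cake formula integrates `φ / (1 + φt)` against the tail of `x`
(`integral_log_one_add_of_tail`). The tails of the maximum and the minimum are sums of exponentials,
each contributing one `Ei` term. The second largest gain reduces to maxima by deleting one user at a
time (`comp_second_eq`).

At high SNR every `e^{l/φ} Ei(-l/φ)` diverges in the same way, and differences converge to
logarithms by a Frullani integral (`tendsto_exp_mul_Ei_sub`). The divergent part cancels between the
two users. If `D` is the difference of their expected logarithms, the gap is `(D(ρ) - 2 D(ρα²)) /
log 2`, which tends to `-D(∞) / log 2`; hence the limit does not depend on `α`. -/

/-! ### The standard complex Gaussian law -/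

instance : IsProbabilityMeasure stdComplexGaussian :=
  Measure.isProbabilityMeasure_map (Measurable.aemeasurable (by fun_prop))

theorem charFun_stdComplexGaussian (t : ℂ) :
    charFun stdComplexGaussian t = Complex.exp (-(‖t‖ ^ 2 / 4 : ℝ)) := by
  have h1 : ∀ x : ℝ × ℝ, Complex.exp ((inner ℝ (Complex.measurableEquivRealProd.symm x) t : ℝ)
      * Complex.I) = Complex.exp (t.re * x.1 * Complex.I) * Complex.exp (t.im * x.2 * Complex.I) := by
    intro x
    rw [← Complex.exp_add, Complex.inner]
    congr 1
    simp [Complex.measurableEquivRealProd_symm_apply]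
    ring
  rw [charFun_apply, stdComplexGaussian, integral_map (Measurable.aemeasurable (by fun_prop))
    (by fun_prop)]
  simp_rw [h1]
  rw [integral_prod_mul (fun x : ℝ => Complex.exp (t.re * x * Complex.I))
    (fun y : ℝ => Complex.exp (t.im * y * Complex.I)), ← charFun_apply_real, ← charFun_apply_real,
    charFun_gaussianReal, charFun_gaussianReal, ← Complex.exp_add, Complex.sq_norm,
    Complex.normSq_apply]
  congr 1
  push_cast
  ring

/-- The characteristic function depends on `‖t‖²` alone, through an exponent linear in it, so the
two independent factors have exponents adding up with weights `‖a‖²` and `‖b‖²`. -/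
theorem map_linearCombination_stdComplexGaussian {a b : ℂ} (h : ‖a‖ ^ 2 + ‖b‖ ^ 2 = 1) :
    (stdComplexGaussian.prod stdComplexGaussian).map (fun z => a * z.1 + b * z.2)
      = stdComplexGaussian := by
  have : IsProbabilityMeasure ((stdComplexGaussian.prod stdComplexGaussian).map
      (fun z => a * z.1 + b * z.2)) :=
    Measure.isProbabilityMeasure_map (Measurable.aemeasurable (by fun_prop))
  apply Measure.ext_of_charFun
  ext t
  have h1 : ∀ z : ℂ × ℂ, Complex.exp ((inner ℝ (a * z.1 + b * z.2) t : ℝ) * Complex.I)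
      = Complex.exp ((inner ℝ z.1 (star a * t) : ℝ) * Complex.I)
        * Complex.exp ((inner ℝ z.2 (star b * t) : ℝ) * Complex.I) := by
    intro z
    rw [← Complex.exp_add, Complex.inner, Complex.inner, Complex.inner]
    congr 1
    simp
    ring
  rw [charFun_apply, integral_map (Measurable.aemeasurable (by fun_prop))
    (by fun_prop)]
  simp_rw [h1]
  rw [integral_prod_mul (fun z : ℂ => Complex.exp ((inner ℝ z (star a * t) : ℝ) * Complex.I))
    (fun z : ℂ => Complex.exp ((inner ℝ z (star b * t) : ℝ) * Complex.I)),
    ← charFun_apply, ← charFun_apply, charFun_stdComplexGaussian, charFun_stdComplexGaussian,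
    charFun_stdComplexGaussian, ← Complex.exp_add]
  congr 1
  rw [norm_mul, norm_mul, norm_star, norm_star]
  norm_cast
  linear_combination (-(‖t‖ ^ 2 / 4)) * h

theorem integral_mul_exp_neg_sq_Ioi {t : ℝ} (ht : 0 ≤ t) :
    IntegrableOn (fun r : ℝ => 2 * r * Real.exp (-r ^ 2)) (Set.Ioi (√t)) ∧
    ∫ r in Set.Ioi (√t), 2 * r * Real.exp (-r ^ 2) = Real.exp (-t) := by
  have hd : ∀ x ∈ Set.Ici (√t), HasDerivAt (fun r : ℝ => -Real.exp (-r ^ 2))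
      (2 * x * Real.exp (-x ^ 2)) x := by
    intro x _
    have h := (((hasDerivAt_pow 2 x).fun_neg).exp).fun_neg
    refine h.congr_deriv ?_
    push_cast
    ring
  have hpos : ∀ x ∈ Set.Ioi (√t), 0 ≤ 2 * x * Real.exp (-x ^ 2) := by
    intro x hx
    have : 0 ≤ x := (Real.sqrt_nonneg t).trans (le_of_lt hx)
    positivity
  have hlim : Tendsto (fun r : ℝ => -Real.exp (-r ^ 2)) atTop (𝓝 0) := by
    rw [← neg_zero]
    refine (Real.tendsto_exp_neg_atTop_nhds_zero.comp ?_).neg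
    exact tendsto_pow_atTop two_ne_zero
  refine ⟨integrableOn_Ioi_deriv_of_nonneg' hd hpos hlim, ?_⟩
  rw [integral_Ioi_of_hasDerivAt_of_nonneg' hd hpos hlim, Real.sq_sqrt ht]
  simp

theorem gaussianPDF_half_mul (x y : ℝ) :
    gaussianPDF 0 (1 / 2) x * gaussianPDF 0 (1 / 2) y
      = ENNReal.ofReal (Real.pi⁻¹ * Real.exp (-(x ^ 2 + y ^ 2))) := by
  rw [gaussianPDF, gaussianPDF, ← ENNReal.ofReal_mul (gaussianPDFReal_nonneg _ _ _)]
  congr 1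
  simp only [gaussianPDFReal]
  rw [mul_mul_mul_comm, ← Real.exp_add, ← mul_inv, Real.mul_self_sqrt (by positivity)]
  push_cast
  congr 2 <;> ring

/-- In polar coordinates the angle is uniform and the radius has density `2 r exp (-r²)`, an exact
derivative. -/
theorem stdComplexGaussian_norm_sq_gt {t : ℝ} (ht : 0 ≤ t) :
    stdComplexGaussian {z | t < ‖z‖ ^ 2} = ENNReal.ofReal (Real.exp (-t)) := by
  have hm : MeasurableSet {z : ℂ | t < ‖z‖ ^ 2} := measurableSet_lt (by fun_prop) (by fun_prop)
  have hm' : MeasurableSet {x : ℝ × ℝ | t < x.1 ^ 2 + x.2 ^ 2} :=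
    measurableSet_lt (by fun_prop) (by fun_prop)
  have hpre : Complex.measurableEquivRealProd.symm ⁻¹' {z : ℂ | t < ‖z‖ ^ 2}
      = {x : ℝ × ℝ | t < x.1 ^ 2 + x.2 ^ 2} := by
    ext x
    simp only [Set.mem_preimage, Set.mem_ofPred_eq, Complex.measurableEquivRealProd_symm_apply,
      Complex.sq_norm, Complex.normSq_mk, ← sq]
  rw [stdComplexGaussian, Measure.map_apply (by fun_prop) hm, hpre,
    gaussianReal_of_var_ne_zero _ (by norm_num),
    prod_withDensity (measurable_gaussianPDF _ _) (measurable_gaussianPDF _ _),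
    withDensity_apply _ hm', ← lintegral_indicator hm', ← Measure.volume_eq_prod,
    ← lintegral_comp_polarCoord_symm]
  have h2 : ∀ p ∈ polarCoord.target,
      ENNReal.ofReal p.1 • ({x : ℝ × ℝ | t < x.1 ^ 2 + x.2 ^ 2}.indicator
        (fun z => gaussianPDF 0 (1 / 2) z.1 * gaussianPDF 0 (1 / 2) z.2)) (polarCoord.symm p)
      = (Set.Ioi (√t)).indicator (fun r => ENNReal.ofReal (2 * r * Real.exp (-r ^ 2))) p.1
        * ENNReal.ofReal ((2 * Real.pi)⁻¹) := by
    rintro ⟨r, θ⟩ hp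
    have hr : 0 < r := hp.1
    have h3 : (r * Real.cos θ) ^ 2 + (r * Real.sin θ) ^ 2 = r ^ 2 := by
      linear_combination r ^ 2 * Real.sin_sq_add_cos_sq θ
    have h4 : t < r ^ 2 ↔ √t < r := by rw [Real.sqrt_lt' hr]
    simp only [polarCoord_symm_apply, Set.indicator, Set.mem_ofPred_eq, h3, h4, Set.mem_Ioi,
      gaussianPDF_half_mul]
    split_ifs
    · rw [smul_eq_mul, ← ENNReal.ofReal_mul hr.le, ← ENNReal.ofReal_mul (by positivity)]
      congr 1
      field_simp
    · simp
  rw [setLIntegral_congr_fun polarCoord.open_target.measurableSet h2, polarCoord_target,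
    Measure.volume_eq_prod, ← Measure.prod_restrict,
    lintegral_prod_mul (f := (Set.Ioi (√t)).indicator
      (fun r => ENNReal.ofReal (2 * r * Real.exp (-r ^ 2))))
      (g := fun _ => ENNReal.ofReal ((2 * Real.pi)⁻¹))
      (Measurable.aemeasurable (Measurable.indicator (by fun_prop) measurableSet_Ioi))
      (by fun_prop), lintegral_indicator measurableSet_Ioi,
    Measure.restrict_restrict measurableSet_Ioi,
    Set.inter_eq_self_of_subset_left (Set.Ioi_subset_Ioi (Real.sqrt_nonneg t)),
    ← ofReal_integral_eq_lintegral_ofReal (integral_mul_exp_neg_sq_Ioi ht).1,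
    (integral_mul_exp_neg_sq_Ioi ht).2]
  · rw [lintegral_const, Measure.restrict_apply_univ, Real.volume_Ioo,
      ← ENNReal.ofReal_mul (by positivity), ← ENNReal.ofReal_mul (by positivity)]
    congr 1
    field_simp
    ring
  · filter_upwards [ae_restrict_mem measurableSet_Ioi] with r hr
    have : 0 ≤ r := (Real.sqrt_nonneg t).trans (le_of_lt hr)
    change (0 : ℝ) ≤ _
    positivity

theorem stdComplexGaussian_singleton_zero : stdComplexGaussian {0} = 0 := by
  have h := stdComplexGaussian_norm_sq_gt le_rfl
  have h1 : {z : ℂ | 0 < ‖z‖ ^ 2} = {0}ᶜ := by ext z; simp [sq_pos_iff]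
  rw [h1, neg_zero, Real.exp_zero, ENNReal.ofReal_one,
    prob_compl_eq_one_iff (measurableSet_singleton 0)] at h
  exact h

/-! ### Law of the determinant ratio, and independence of blocks -/

/-- The coefficients `(q, -p)` divided by the norm of `(p, q)` form a unit vector, so rotation
invariance applies. -/
theorem ratio_law_of_fixed {p q : ℂ} (hpq : 0 < ‖p‖ ^ 2 + ‖q‖ ^ 2) {t : ℝ} (ht : 0 ≤ t) :
    (stdComplexGaussian.prod stdComplexGaussian)
      {z | t < ‖z.1 * q - z.2 * p‖ ^ 2 / (‖p‖ ^ 2 + ‖q‖ ^ 2)} = ENNReal.ofReal (Real.exp (-t)) := by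
  set s : ℝ := √(‖p‖ ^ 2 + ‖q‖ ^ 2) with hs
  have hs2 : s ^ 2 = ‖p‖ ^ 2 + ‖q‖ ^ 2 := Real.sq_sqrt hpq.le
  have hs0 : s ≠ 0 := (Real.sqrt_pos.2 hpq).ne'
  have hn : ‖q / s‖ ^ 2 + ‖-p / s‖ ^ 2 = 1 := by
    rw [norm_div, norm_div, norm_neg, div_pow, div_pow, Complex.norm_real, Real.norm_eq_abs,
      sq_abs, ← add_div, hs2, add_comm, div_self hpq.ne']
  rw [← stdComplexGaussian_norm_sq_gt ht, ← map_linearCombination_stdComplexGaussian hn,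
    Measure.map_apply (by fun_prop) (measurableSet_lt (by fun_prop) (by fun_prop)),
    map_linearCombination_stdComplexGaussian hn]
  congr 1
  ext z
  have : q / s * z.1 + -p / s * z.2 = (z.1 * q - z.2 * p) / s := by ring
  simp only [Set.mem_ofPred_eq, Set.mem_preimage, this]
  rw [norm_div, div_pow, Complex.norm_real, Real.norm_eq_abs, sq_abs, hs2]

theorem ratio_law {t : ℝ} (ht : 0 ≤ t) :
    ((stdComplexGaussian.prod stdComplexGaussian).prod
        (stdComplexGaussian.prod stdComplexGaussian))
      {w | t < ‖w.1.1 * w.2.2 - w.1.2 * w.2.1‖ ^ 2 / (‖w.2.1‖ ^ 2 + ‖w.2.2‖ ^ 2)}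
      = ENNReal.ofReal (Real.exp (-t)) := by
  rw [Measure.prod_apply_symm (measurableSet_lt (by fun_prop) (by fun_prop))]
  -- After Fubini the conditional tail does not depend on the fixed column, as long as that column
  -- is nonzero.
  have hz : ∀ᵐ y ∂(stdComplexGaussian.prod stdComplexGaussian), y.1 ≠ 0 := by
    refine Measure.quasiMeasurePreserving_fst.ae (p := fun z : ℂ => z ≠ 0) ?_
    rw [ae_iff]
    simpa using stdComplexGaussian_singleton_zero
  rw [lintegral_congr_ae (g := fun _ => ENNReal.ofReal (Real.exp (-t)))]
  · simp
  · filter_upwards [hz] with y hy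
    exact ratio_law_of_fixed (p := y.1) (q := y.2) (by positivity) ht

/-- Independence says that the joint law is a product measure, and currying turns a product over `ι
× κ` into a product of products. This passes from independent entries to independent channel
matrices. -/
theorem iIndepFun_curry {Ω ι κ X : Type*} [MeasurableSpace Ω] [MeasurableSpace X] [Finite ι]
    [Finite κ] {μ : Measure Ω} {ν : Measure X} [IsProbabilityMeasure ν] {f : ι × κ → Ω → X}
    (hf : ∀ p, HasLaw (f p) ν μ) (h : iIndepFun f μ) :
    iIndepFun (fun (i : ι) ω (j : κ) => f (i, j) ω) μ := by
  have := h.isProbabilityMeasure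
  have h1 : ∀ i, HasLaw (fun ω (j : κ) => f (i, j) ω) (Measure.infinitePi fun _ : κ => ν) μ :=
    fun i => (h.precomp (Prod.mk_right_injective i)).hasLaw_infinitePi (fun j => hf (i, j))
      (aemeasurable_pi_iff.2 fun j => (hf (i, j)).aemeasurable)
  have h2 : HasLaw (fun ω p => f p ω) (Measure.infinitePi fun _ : ι × κ => ν) μ :=
    h.hasLaw_infinitePi hf (aemeasurable_pi_iff.2 fun j => (hf j).aemeasurable)
  rw [iIndepFun_iff_hasLaw_Pi_infinitePi h1
    (aemeasurable_pi_iff.2 fun i => (h1 i).aemeasurable)]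
  have h3 : HasLaw (MeasurableEquiv.curry ι κ X)
      (Measure.infinitePi fun _ : ι => Measure.infinitePi fun _ : κ => ν)
      (Measure.infinitePi fun _ : ι × κ => ν) :=
    { aemeasurable := (MeasurableEquiv.measurable _).aemeasurable
      map_eq := Measure.infinitePi_map_curry (fun _ _ => ν) }
  exact h3.comp h2

/-! ### Detection vectors and effective gains -/

theorem dotProduct_star_self {n : ℕ} (w : Fin n → ℂ) : star w ⬝ᵥ w = ((vecNorm w ^ 2 : ℝ) : ℂ) := by
  rw [vecNorm, EuclideanSpace.norm_sq_eq, dotProduct]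
  push_cast
  refine Finset.sum_congr rfl fun i _ => ?_
  simp [Complex.conj_mul']

theorem star_detVec_dotProduct {M N r : ℕ} (i : Fin M) (H : Matrix (Fin N) (Fin M) ℂ)
    (U : Matrix (Fin N) (Fin r) ℂ) :
    star (detVec i H U) ⬝ᵥ H.col i = ((vecNorm (Uᴴ *ᵥ H.col i) : ℝ) : ℂ) := by
  rw [detVec, Matrix.star_mulVec, ← Matrix.dotProduct_mulVec, mrcWeight, star_smul,
    smul_dotProduct, dotProduct_star_self]
  -- In the degenerate case the weight is zero, because the inverse of zero is zero, and both sides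
  -- vanish.
  by_cases h : vecNorm (Uᴴ *ᵥ H.col i) = 0
  · simp [h]
  · have : ((vecNorm (Uᴴ *ᵥ H.col i) : ℝ) : ℂ) ≠ 0 := by exact_mod_cast h
    simp only [star_inv₀, RCLike.star_def, Complex.conj_ofReal, smul_eq_mul, Complex.ofReal_pow]
    field_simp

theorem gain_eq_vecNorm_sq {M N r : ℕ} (i : Fin M) (H : Matrix (Fin N) (Fin M) ℂ)
    (U : Matrix (Fin N) (Fin r) ℂ) : gain i H U = vecNorm (Uᴴ *ᵥ H.col i) ^ 2 := by
  rw [gain, star_detVec_dotProduct, Complex.norm_real, Real.norm_eq_abs, sq_abs]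

theorem gain_nonneg {M N r : ℕ} (i : Fin M) (H : Matrix (Fin N) (Fin M) ℂ)
    (U : Matrix (Fin N) (Fin r) ℂ) : 0 ≤ gain i H U := sq_nonneg _

theorem vecNorm_detVec_sq {M N r : ℕ} {i : Fin M} {H : Matrix (Fin N) (Fin M) ℂ}
    {U : Matrix (Fin N) (Fin r) ℂ} (hU : Uᴴ * U = 1) (h : gain i H U ≠ 0) :
    vecNorm (detVec i H U) ^ 2 = 1 := by
  rw [gain_eq_vecNorm_sq] at h
  have h0 : ((vecNorm (Uᴴ *ᵥ H.col i) : ℝ) : ℂ) ≠ 0 := by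
    intro h'
    exact h (by rw [Complex.ofReal_eq_zero.1 h']; simp)
  rw [← Complex.ofReal_inj, ← dotProduct_star_self, detVec, Matrix.star_mulVec,
    ← Matrix.dotProduct_mulVec, Matrix.mulVec_mulVec, hU, Matrix.one_mulVec, mrcWeight, star_smul,
    smul_dotProduct, dotProduct_smul, dotProduct_star_self]
  simp only [star_inv₀, RCLike.star_def, Complex.conj_ofReal, smul_eq_mul, Complex.ofReal_pow]
  field_simp
  simp

theorem snrWeak_eq {M N r : ℕ} {i : Fin M} {H : Matrix (Fin N) (Fin M) ℂ}
    {U : Matrix (Fin N) (Fin r) ℂ} (hU : Uᴴ * U = 1) (ρ a b : ℝ) :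
    snrWeak ρ a b i H U = gain i H U * b ^ 2 / (gain i H U * a ^ 2 + 1 / ρ) := by
  by_cases h : gain i H U = 0
  · simp [snrWeak, h]
  · rw [snrWeak, vecNorm_detVec_sq hU h, one_mul]

theorem snrStrong_eq {M N r : ℕ} {i : Fin M} {H : Matrix (Fin N) (Fin M) ℂ}
    {U : Matrix (Fin N) (Fin r) ℂ} (hU : Uᴴ * U = 1) (ρ a : ℝ) :
    snrStrong ρ a i H U = ρ * a ^ 2 * gain i H U := by
  by_cases h : gain i H U = 0
  · simp [snrStrong, h]
  · rw [snrStrong, vecNorm_detVec_sq hU h, div_one]; ring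

/-- Squared modulus of the determinant divided by the squared norm of the interfering column. -/
noncomputable def detRatio (i : Fin 2) (A : Fin 2 × Fin 2 → ℂ) : ℝ :=
  ‖A (0, i) * A (1, 1 - i) - A (1, i) * A (0, 1 - i)‖ ^ 2
    / (‖A (0, 1 - i)‖ ^ 2 + ‖A (1, 1 - i)‖ ^ 2)

theorem measurable_detRatio (i : Fin 2) : Measurable (detRatio i) := by
  unfold detRatio
  fun_prop

/-- Write `u` for the column of `U`, `g` for the interfering column (index `1 - i`), `c = uᴴh` and
`D` for the determinant up to sign. Orthogonality of `u` and `g` gives `c g₁ = ū₀ D` and `c g₀ = -ū₁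
D`. Squaring moduli and adding, with `|u| = 1`, gives `|c|² |g|² = |D|²`. -/
theorem gain_eq_detRatio {i : Fin 2} {H : Matrix (Fin 2) (Fin 2) ℂ}
    {U : Matrix (Fin 2) (Fin (2 - 2 + 1)) ℂ} (hU : IsNullBasis i H U) (hH : H 0 (1 - i) ≠ 0) :
    gain i H U = detRatio i fun p => H p.1 p.2 := by
  obtain ⟨h1, h2⟩ := hU
  have hi : (1 - i : Fin 2) ≠ i := by fin_cases i <;> decide
  have h3 : star (U 0 0) * H 0 (1 - i) + star (U 1 0) * H 1 (1 - i) = 0 := by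
    have := congrFun (h2 _ hi) 0
    simpa [Matrix.mulVec, dotProduct, Fin.sum_univ_two] using this
  have h4 : ‖U 0 0‖ ^ 2 + ‖U 1 0‖ ^ 2 = 1 := by
    have := congrFun (congrFun h1 0) 0
    simp only [Matrix.mul_apply, Fin.sum_univ_two, Matrix.conjTranspose_apply, RCLike.star_def,
      Complex.conj_mul', Matrix.one_apply_eq] at this
    exact_mod_cast this
  set c : ℂ := star (U 0 0) * H 0 i + star (U 1 0) * H 1 i with hc
  set D : ℂ := H 0 i * H 1 (1 - i) - H 1 i * H 0 (1 - i) with hD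
  have hg : gain i H U = ‖c‖ ^ 2 := by
    rw [gain_eq_vecNorm_sq, vecNorm, EuclideanSpace.norm_sq_eq]
    simp [Matrix.mulVec, dotProduct, Fin.sum_univ_two, hc]
  have e1 : c * H 1 (1 - i) = star (U 0 0) * D := by
    rw [hc, hD]; linear_combination H 1 i * h3
  have e2 : c * H 0 (1 - i) = -(star (U 1 0) * D) := by
    rw [hc, hD]; linear_combination H 0 i * h3
  have f1 := congrArg (‖·‖ ^ 2) e1
  have f2 := congrArg (‖·‖ ^ 2) e2
  simp only [norm_mul, norm_neg, norm_star, mul_pow] at f1 f2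
  have hpos : 0 < ‖H 0 (1 - i)‖ ^ 2 + ‖H 1 (1 - i)‖ ^ 2 := by positivity
  rw [hg, detRatio, eq_div_iff hpos.ne', ← hD]
  linear_combination f1 + f2 + ‖D‖ ^ 2 * h4

theorem ae_gain_eq_detRatio {Ω : Type*} [MeasurableSpace Ω] {μ : Measure Ω} {K : ℕ}
    {G : Fin 2 → Fin K → Ω → Matrix (Fin 2) (Fin 2) ℂ} (hG : IsRayleigh G μ)
    {U : Fin 2 → Fin K → Ω → Matrix (Fin 2) (Fin (2 - 2 + 1)) ℂ}
    (hU : ∀ i j ω, IsNullBasis i (G i j ω) (U i j ω)) (i : Fin 2) (j : Fin K) :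
    (fun ω => gain i (G i j ω) (U i j ω)) =ᵐ[μ] fun ω => detRatio i fun p => G i j ω p.1 p.2 := by
  have h : ∀ᵐ ω ∂μ, G i j ω 0 (1 - i) ≠ 0 := by
    refine ((hG.hasLaw i j 0 (1 - i)).ae_iff (p := fun z => z ≠ 0)
      (measurableSet_setOfPred.1 (measurableSet_singleton 0).compl)).2 ?_
    rw [ae_iff]
    simpa using stdComplexGaussian_singleton_zero
  filter_upwards [h] with ω hω
  exact gain_eq_detRatio (hU i j ω) hω

theorem iIndepFun_detRatio {Ω : Type*} [MeasurableSpace Ω] {μ : Measure Ω} {K : ℕ}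
    {G : Fin 2 → Fin K → Ω → Matrix (Fin 2) (Fin 2) ℂ} (hG : IsRayleigh G μ) (i : Fin 2) :
    iIndepFun (fun (j : Fin K) ω => detRatio i fun p => G i j ω p.1 p.2) μ := by
  have h := iIndepFun_curry (ι := Fin K) (κ := Fin 2 × Fin 2)
    (f := fun p ω => G i p.1 ω p.2.1 p.2.2) (fun p => hG.hasLaw i p.1 p.2.1 p.2.2)
    (hG.indep.precomp (g := fun q : Fin K × Fin 2 × Fin 2 => (i, q)) (Prod.mk_right_injective i))
  exact h.comp (fun _ => detRatio i) (fun _ => measurable_detRatio i)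

theorem aemeasurable_detRatio {Ω : Type*} [MeasurableSpace Ω] {μ : Measure Ω} {K : ℕ}
    {G : Fin 2 → Fin K → Ω → Matrix (Fin 2) (Fin 2) ℂ} (hG : IsRayleigh G μ) (i : Fin 2)
    (j : Fin K) : AEMeasurable (fun ω => detRatio i fun p => G i j ω p.1 p.2) μ :=
  (measurable_detRatio i).comp_aemeasurable
    (aemeasurable_pi_iff.2 fun p => (hG.hasLaw i j p.1 p.2).aemeasurable)

theorem measure_detRatio_gt {Ω : Type*} [MeasurableSpace Ω] {μ : Measure Ω} {K : ℕ}
    {G : Fin 2 → Fin K → Ω → Matrix (Fin 2) (Fin 2) ℂ} (hG : IsRayleigh G μ) (i : Fin 2)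
    (j : Fin K) {t : ℝ} (ht : 0 ≤ t) :
    μ {ω | t < detRatio i fun p => G i j ω p.1 p.2} = ENNReal.ofReal (Real.exp (-t)) := by
  have := hG.indep.isProbabilityMeasure
  have hi : (1 - i : Fin 2) ≠ i := by fin_cases i <;> decide
  have hae : ∀ p : Fin 2 × Fin K × Fin 2 × Fin 2,
      AEMeasurable (fun ω => G p.1 p.2.1 ω p.2.2.1 p.2.2.2) μ :=
    fun p => (hG.hasLaw p.1 p.2.1 p.2.2.1 p.2.2.2).aemeasurable
  have h2 : ∀ m, HasLaw (fun ω => (G i j ω 0 m, G i j ω 1 m))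
      (stdComplexGaussian.prod stdComplexGaussian) μ := fun m =>
    (hG.indep.indepFun (i := (i, j, 0, m)) (j := (i, j, 1, m)) (by simp)).hasLaw_prod
      (hG.hasLaw i j 0 m) (hG.hasLaw i j 1 m)
  have h3 := (hG.indep.indepFun_prodMk_prodMk₀ hae (i, j, 0, i) (i, j, 1, i) (i, j, 0, 1 - i)
    (i, j, 1, 1 - i) (by simp [hi.symm]) (by simp) (by simp)
    (by simp [hi.symm])).hasLaw_prod (h2 i) (h2 (1 - i))
  rw [← ratio_law ht]
  exact h3.measure_eq (p := fun w => t < ‖w.1.1 * w.2.2 - w.1.2 * w.2.1‖ ^ 2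
    / (‖w.2.1‖ ^ 2 + ‖w.2.2‖ ^ 2)) (measurableSet_lt (by fun_prop) (by fun_prop))

/-! ### Expected logarithms from exponential tails -/

theorem integrableOn_exp_neg_mul_Ioi {l : ℝ} (hl : 0 < l) :
    IntegrableOn (fun t : ℝ => Real.exp (-(l * t))) (Set.Ioi 0) := by
  simpa only [neg_mul] using exp_neg_integrableOn_Ioi 0 hl

theorem integrableOn_laplace_kernel {φ l : ℝ} (hφ : 0 < φ) (hl : 0 < l) :
    IntegrableOn (fun t : ℝ => φ / (1 + φ * t) * Real.exp (-(l * t))) (Set.Ioi 0) := by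
  refine ((integrableOn_exp_neg_mul_Ioi hl).const_mul φ).mono'
    (Measurable.aestronglyMeasurable (by fun_prop)) ?_
  filter_upwards [ae_restrict_mem measurableSet_Ioi] with t ht
  have ht' : 0 < φ * t := mul_pos hφ ht
  rw [Real.norm_of_nonneg (by positivity)]
  gcongr
  exact div_le_self hφ.le (by linarith)

theorem integral_laplace_kernel {φ l : ℝ} (hφ : 0 < φ) (hl : 0 < l) :
    ∫ t in Set.Ioi 0, φ / (1 + φ * t) * Real.exp (-(l * t))
      = -(Real.exp (l / φ) * Ei (-(l / φ))) := by
  -- The substitution `x = -l (t + 1/φ)` is performed as a translation, a scaling and a reflection.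
  have hmp := (measurePreserving_add_right (volume : Measure ℝ) (1 / φ)).setIntegral_preimage_emb
    (measurableEmbedding_addRight (1 / φ)) (fun x => Real.exp (-(l * x)) / (-(l * x)))
    (Set.Ioi (1 / φ))
  have hpre : (fun x => x + 1 / φ) ⁻¹' Set.Ioi (1 / φ) = Set.Ioi 0 := by ext; simp
  rw [hpre] at hmp
  rw [Ei, ← integral_comp_neg_Ioi (l / φ) (fun t => Real.exp t / t),
    show l / φ = l * (1 / φ) by ring,
    ← integral_comp_mul_left_Ioi' (fun x => Real.exp (-x) / -x) (1 / φ) hl, ← hmp,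
    smul_eq_mul, ← mul_assoc, ← integral_const_mul, ← integral_neg]
  refine setIntegral_congr_fun measurableSet_Ioi fun t ht => ?_
  have ht' : 0 < t := ht
  have h1 : 0 < t + 1 / φ := by positivity
  have h2 : 0 < 1 + φ * t := by positivity
  have h3 : Real.exp (-(l * t)) = Real.exp (l * (1 / φ)) * Real.exp (-(l * (t + 1 / φ))) := by
    rw [← Real.exp_add]; congr 1; ring
  have h4 : φ / (1 + φ * t) = 1 / (t + 1 / φ) := by field_simp; ring
  simp only [h3, h4]
  field_simp

/-- Layer cake for `log (1 + φ x)`, the integral of `φ / (1 + φu)` over `[0, x]`. The exponents `l`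
are at least one, so every term of the tail is separately integrable. -/
theorem integral_log_one_add_of_tail {Ω : Type*} [MeasurableSpace Ω] {μ : Measure Ω}
    [IsFiniteMeasure μ] {X : Ω → ℝ} (hX : AEMeasurable X μ) (h0 : 0 ≤ᵐ[μ] X) {s : Finset ℕ}
    {c : ℕ → ℝ} (hs : ∀ l ∈ s, 1 ≤ l)
    (htail : ∀ t > 0, μ.real {ω | t < X ω} = ∑ l ∈ s, c l * Real.exp (-(l * t)))
    {φ : ℝ} (hφ : 0 < φ) :
    Integrable (fun ω => Real.log (1 + φ * X ω)) μ ∧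
      ∫ ω, Real.log (1 + φ * X ω) ∂μ
        = -∑ l ∈ s, c l * (Real.exp (l / φ) * Ei (-(l / φ))) := by
  have hpos : ∀ l ∈ s, (0 : ℝ) < l := fun l hl => by exact_mod_cast hs l hl
  have hint : IntegrableOn (fun t : ℝ => ∑ l ∈ s, c l * (φ / (1 + φ * t) * Real.exp (-(l * t))))
      (Set.Ioi 0) :=
    integrable_finsetSum _ fun l hl => (integrableOn_laplace_kernel hφ (hpos l hl)).const_mul _
  have hcont : ∀ t : ℝ, 0 ≤ t → ContinuousOn (fun u : ℝ => φ / (1 + φ * u)) (Set.uIcc 0 t) := by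
    intro t ht
    refine continuousOn_const.div (by fun_prop) fun u hu => ?_
    rw [Set.uIcc_of_le ht] at hu
    have := mul_nonneg hφ.le hu.1
    positivity
  have hlog : ∀ x : ℝ, 0 ≤ x → ∫ u in (0 : ℝ)..x, φ / (1 + φ * u) = Real.log (1 + φ * x) := by
    intro x hx
    rw [intervalIntegral.integral_eq_sub_of_hasDerivAt (f := fun u => Real.log (1 + φ * u))
      _ (hcont x hx).intervalIntegrable]
    · simp
    · intro u hu
      rw [Set.uIcc_of_le hx] at hu
      have := mul_nonneg hφ.le hu.1
      have h := (((hasDerivAt_id u).const_mul φ).const_add 1).log (by simp; positivity)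
      simpa using h
  have hkey := lintegral_comp_eq_lintegral_meas_lt_mul μ h0 hX
    (g := fun u => φ / (1 + φ * u)) (fun t ht => (hcont t ht.le).intervalIntegrable) (by
      filter_upwards [ae_restrict_mem measurableSet_Ioi] with t ht
      have := mul_pos hφ ht
      positivity)
  have htaileq : ∀ t ∈ Set.Ioi (0 : ℝ), μ {ω | t < X ω} * ENNReal.ofReal (φ / (1 + φ * t))
      = ENNReal.ofReal (∑ l ∈ s, c l * (φ / (1 + φ * t) * Real.exp (-(l * t)))) := by
    intro t ht
    rw [← ofReal_measureReal, htail t ht, ← ENNReal.ofReal_mul, Finset.sum_mul]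
    · congr 1
      exact Finset.sum_congr rfl fun l _ => by ring
    · rw [← htail t ht]; exact measureReal_nonneg
  -- The coefficients `c l` may have either sign; the sum is nonnegative because it is the kernel
  -- times a probability.
  have hnn : 0 ≤ᵐ[volume.restrict (Set.Ioi 0)]
      fun t : ℝ => ∑ l ∈ s, c l * (φ / (1 + φ * t) * Real.exp (-(l * t))) := by
    filter_upwards [ae_restrict_mem measurableSet_Ioi] with t ht
    have h1 : 0 < φ * t := mul_pos hφ ht
    have h2 : ∑ l ∈ s, c l * (φ / (1 + φ * t) * Real.exp (-(l * t)))
        = φ / (1 + φ * t) * μ.real {ω | t < X ω} := by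
      rw [htail t ht, Finset.mul_sum]
      exact Finset.sum_congr rfl fun l _ => by ring
    rw [h2]
    exact mul_nonneg (by positivity) measureReal_nonneg
  rw [setLIntegral_congr_fun measurableSet_Ioi htaileq,
    ← ofReal_integral_eq_lintegral_ofReal hint hnn,
    lintegral_congr_ae (g := fun ω => ENNReal.ofReal (Real.log (1 + φ * X ω)))
      (by filter_upwards [h0] with ω hω using by rw [hlog _ hω])] at hkey
  have hm : AEStronglyMeasurable (fun ω => Real.log (1 + φ * X ω)) μ :=
    (Real.measurable_log.comp_aemeasurable
      ((hX.const_mul φ).const_add 1)).aestronglyMeasurable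
  have hlognn : 0 ≤ᵐ[μ] fun ω => Real.log (1 + φ * X ω) := by
    filter_upwards [h0] with ω hω
    have := mul_nonneg hφ.le hω
    exact Real.log_nonneg (by linarith)
  refine ⟨(lintegral_ofReal_ne_top_iff_integrable hm hlognn).1
    (by rw [hkey]; exact ENNReal.ofReal_ne_top), ?_⟩
  rw [integral_eq_lintegral_of_nonneg_ae hlognn hm, hkey,
    ENNReal.toReal_ofReal (integral_nonneg_of_ae hnn),
    integral_finsetSum _ fun l hl => (integrableOn_laplace_kernel hφ (hpos l hl)).const_mul _,
    ← Finset.sum_neg_distrib]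
  refine Finset.sum_congr rfl fun l hl => ?_
  rw [integral_const_mul, integral_laplace_kernel hφ (hpos l hl), mul_neg]

/-- The binomial theorem without its constant term. At `x = exp (-t)` it expands the tail of a
maximum; at `x = 1` it shows that the coefficients sum to `-1`. -/
theorem sum_Icc_choose_mul_pow (n : ℕ) (x : ℝ) :
    ∑ l ∈ Finset.Icc 1 n, (n.choose l : ℝ) * (-1) ^ l * x ^ l = (1 - x) ^ n - 1 := by
  have h : (1 - x) ^ n = ∑ l ∈ Finset.range (n + 1), (n.choose l : ℝ) * (-1) ^ l * x ^ l := by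
    rw [sub_eq_neg_add, add_pow]
    refine Finset.sum_congr rfl fun l _ => ?_
    rw [neg_pow x]; ring
  rw [h, Finset.range_eq_Ico, Finset.sum_eq_sum_Ico_succ_bot (Nat.succ_pos n)]
  simp [Finset.Ico_add_one_right_eq_Icc]

/-- The sum `S_m(φ)` of weighted exponential integrals. -/
noncomputable def eiSum (m : ℕ) (φ : ℝ) : ℝ :=
  ∑ l ∈ Finset.Icc 1 m, (m.choose l : ℝ) * (-1) ^ l * Real.exp (l / φ) * Ei (-(l / φ))

/-! ### Maxima and minima of i.i.d. exponential variables -/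

section ExponentialSample

variable {Ω ι : Type*} [MeasurableSpace Ω] {μ : Measure Ω} {Y : ι → Ω → ℝ}

theorem aemeasurable_sup' (hm : ∀ j, AEMeasurable (Y j) μ) (s : Finset ι) (hs : s.Nonempty) :
    AEMeasurable (fun ω => s.sup' hs fun j => Y j ω) μ := by
  have h := Finset.sup'_induction (p := fun f : Ω → ℝ => AEMeasurable f μ) hs Y
    (fun _ hf _ hg => hf.sup hg) fun j _ => hm j
  convert! h using 1
  ext ω
  simp

theorem aemeasurable_inf' (hm : ∀ j, AEMeasurable (Y j) μ) (s : Finset ι) (hs : s.Nonempty) :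
    AEMeasurable (fun ω => s.inf' hs fun j => Y j ω) μ := by
  have h := Finset.inf'_induction (p := fun f : Ω → ℝ => AEMeasurable f μ) hs Y
    (fun _ hf _ hg => hf.inf hg) fun j _ => hm j
  convert! h using 1
  ext ω
  simp

variable (hi : iIndepFun Y μ) (hm : ∀ j, AEMeasurable (Y j) μ) (h0 : ∀ j, 0 ≤ᵐ[μ] Y j)
  (hY : ∀ j, ∀ t, 0 ≤ t → μ {ω | t < Y j ω} = ENNReal.ofReal (Real.exp (-t)))

include hi hm hY in
theorem measureReal_sup'_gt (s : Finset ι) (hs : s.Nonempty) {t : ℝ} (ht : 0 ≤ t) :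
    μ.real {ω | t < s.sup' hs fun j => Y j ω} = 1 - (1 - Real.exp (-t)) ^ s.card := by
  have := hi.isProbabilityMeasure
  have h1 : {ω | t < s.sup' hs fun j => Y j ω} = (⋂ j ∈ s, Y j ⁻¹' Set.Iic t)ᶜ := by
    ext ω; simp
  have h2 : ∀ j, μ.real (Y j ⁻¹' Set.Iic t) = 1 - Real.exp (-t) := by
    intro j
    have h3 : Y j ⁻¹' Set.Iic t = {ω | t < Y j ω}ᶜ := by ext; simp
    rw [h3, probReal_compl_eq_one_sub₀ (show NullMeasurableSet {ω | t < Y j ω} μ from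
      (hm j).nullMeasurable measurableSet_Ioi), Measure.real,
      hY j t ht, ENNReal.toReal_ofReal (Real.exp_pos _).le]
  rw [h1, probReal_compl_eq_one_sub₀ (s.nullMeasurableSet_biInter fun j _ =>
    (hm j).nullMeasurable measurableSet_Iic), Measure.real,
    hi.measure_inter_preimage_eq_mul s fun _ _ => measurableSet_Iic, ENNReal.toReal_prod]
  simp_rw [← Measure.real_def, h2]
  simp

include hi hY in
theorem measureReal_inf'_gt (s : Finset ι) (hs : s.Nonempty) {t : ℝ} (ht : 0 ≤ t) :
    μ.real {ω | t < s.inf' hs fun j => Y j ω} = Real.exp (-(s.card * t)) := by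
  have h1 : {ω | t < s.inf' hs fun j => Y j ω} = ⋂ j ∈ s, Y j ⁻¹' Set.Ioi t := by
    ext ω; simp
  have h2 : ∀ j, μ (Y j ⁻¹' Set.Ioi t) = ENNReal.ofReal (Real.exp (-t)) := fun j => hY j t ht
  rw [h1, Measure.real, hi.measure_inter_preimage_eq_mul s fun _ _ => measurableSet_Ioi,
    ENNReal.toReal_prod]
  simp_rw [h2, ENNReal.toReal_ofReal (Real.exp_pos _).le]
  rw [Finset.prod_const, ← Real.exp_nat_mul]
  congr 1
  ring

include hi hm h0 hY

theorem integral_log_one_add_sup' (s : Finset ι) (hs : s.Nonempty) {φ : ℝ} (hφ : 0 < φ) :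
    Integrable (fun ω => Real.log (1 + φ * s.sup' hs fun j => Y j ω)) μ ∧
      ∫ ω, Real.log (1 + φ * s.sup' hs fun j => Y j ω) ∂μ = eiSum s.card φ := by
  have := hi.isProbabilityMeasure
  have hnn : 0 ≤ᵐ[μ] fun ω => s.sup' hs fun j => Y j ω := by
    obtain ⟨j, hj⟩ := hs
    filter_upwards [h0 j] with ω hω
    exact le_trans hω (Finset.le_sup' (fun j => Y j ω) hj)
  have h := integral_log_one_add_of_tail (aemeasurable_sup' hm s hs) hnn
    (s := Finset.Icc 1 s.card) (c := fun l => -((s.card.choose l : ℝ) * (-1) ^ l))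
    (fun l hl => (Finset.mem_Icc.1 hl).1) (fun t ht => by
      rw [measureReal_sup'_gt hi hm hY s hs (le_of_lt ht)]
      have := sum_Icc_choose_mul_pow s.card (Real.exp (-t))
      simp_rw [← Real.exp_nat_mul, mul_neg] at this
      simp_rw [neg_mul, Finset.sum_neg_distrib] at this ⊢
      linarith) hφ
  refine ⟨h.1, ?_⟩
  rw [h.2, eiSum, ← Finset.sum_neg_distrib]
  exact Finset.sum_congr rfl fun l _ => by ring

theorem integral_log_one_add_inf' (s : Finset ι) (hs : s.Nonempty) {φ : ℝ} (hφ : 0 < φ) :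
    Integrable (fun ω => Real.log (1 + φ * s.inf' hs fun j => Y j ω)) μ ∧
      ∫ ω, Real.log (1 + φ * s.inf' hs fun j => Y j ω) ∂μ
        = -(Real.exp (s.card / φ) * Ei (-(s.card / φ))) := by
  have := hi.isProbabilityMeasure
  have hnn : 0 ≤ᵐ[μ] fun ω => s.inf' hs fun j => Y j ω := by
    have h : ∀ᵐ ω ∂μ, ∀ j ∈ s, 0 ≤ Y j ω :=
      (Filter.eventually_all_finset s).2 fun j _ => h0 j
    filter_upwards [h] with ω hω
    exact Finset.le_inf' _ _ hω
  have h := integral_log_one_add_of_tail (aemeasurable_inf' hm s hs) hnn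
    (s := {s.card}) (c := fun _ => 1) (by simpa using hs)
    (fun t ht => by
      rw [measureReal_inf'_gt hi hY s hs (le_of_lt ht)]; simp) hφ
  simpa using h

end ExponentialSample

/-! ### High-SNR asymptotics of the exponential integrals -/

/-- The difference is the integral of `φ / (1 + φt)` against `exp (-t) - exp (-l t)`. The kernel
increases to `1/t`, and the limiting integral is Frullani's. -/
theorem tendsto_exp_mul_Ei_sub {l : ℝ} (hl : 1 ≤ l) :
    Tendsto (fun φ : ℝ => Real.exp (l / φ) * Ei (-(l / φ)) - Real.exp (1 / φ) * Ei (-(1 / φ)))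
      atTop (𝓝 (Real.log l)) := by
  have hl0 : 0 < l := by linarith
  -- From `1 - exp (-s) ≤ s` with `s = (l - 1) t`. The factor `t` absorbs the singularity of `1/t`,
  -- leaving an integrable majorant.
  have hbound : ∀ t : ℝ, 0 < t → 0 ≤ Real.exp (-(1 * t)) - Real.exp (-(l * t)) ∧
      Real.exp (-(1 * t)) - Real.exp (-(l * t)) ≤ t * ((l - 1) * Real.exp (-(1 * t))) := by
    intro t ht
    have h1 : Real.exp (-(l * t)) = Real.exp (-(1 * t)) * Real.exp (-((l - 1) * t)) := by
      rw [← Real.exp_add]; congr 1; ring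
    have h2 := Real.add_one_le_exp (-((l - 1) * t))
    have h3 : Real.exp (-((l - 1) * t)) ≤ 1 :=
      Real.exp_le_one_iff.2 (by nlinarith)
    have h4 := Real.exp_pos (-(1 * t))
    rw [h1]
    constructor <;> nlinarith
  have hdom : IntegrableOn (fun t : ℝ => (l - 1) * Real.exp (-(1 * t))) (Set.Ioi 0) :=
    (integrableOn_exp_neg_mul_Ioi one_pos).const_mul _
  have hfr : ∫ t in Set.Ioi (0 : ℝ), t⁻¹ * (Real.exp (-(1 * t)) - Real.exp (-(l * t)))
      = Real.log l := by
    have hc : Continuous fun x : ℝ => Real.exp (-x) := by fun_prop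
    have h := Frullani.integral_Ioi_eq (f := fun x : ℝ => Real.exp (-x)) (a := 1) (b := l)
      (L := 1) (R := 0) (hc.locallyIntegrable.locallyIntegrableOn _) one_pos hl0
      ((hc.tendsto' 0 1 (by simp)).mono_left nhdsWithin_le_nhds)
      Real.tendsto_exp_neg_atTop_nhds_zero (by
        refine hdom.mono' (Measurable.aestronglyMeasurable (by fun_prop)) ?_
        filter_upwards [ae_restrict_mem measurableSet_Ioi] with t ht
        have ht' : 0 < t := ht
        rw [smul_eq_mul, Real.norm_of_nonneg
          (mul_nonneg (by positivity) (hbound t ht).1), inv_mul_le_iff₀ ht']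
        exact (hbound t ht).2)
    simpa only [smul_eq_mul, div_one, sub_zero, mul_one] using h
  have hT : Tendsto (fun φ : ℝ => ∫ t in Set.Ioi (0 : ℝ),
      φ / (1 + φ * t) * (Real.exp (-(1 * t)) - Real.exp (-(l * t)))) atTop (𝓝 (Real.log l)) := by
    rw [← hfr]
    refine tendsto_integral_filter_of_dominated_convergence _
      (Eventually.of_forall fun φ => Measurable.aestronglyMeasurable (by fun_prop)) ?_ hdom ?_
    · filter_upwards [eventually_gt_atTop 0] with φ hφ
      filter_upwards [ae_restrict_mem measurableSet_Ioi] with t ht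
      have ht' : 0 < t := ht
      have h1 : φ / (1 + φ * t) ≤ t⁻¹ := by
        rw [div_le_iff₀ (by positivity)]
        field_simp
        linarith
      rw [Real.norm_of_nonneg (mul_nonneg (by positivity) (hbound t ht).1)]
      refine (mul_le_mul_of_nonneg_right h1 (hbound t ht).1).trans ?_
      rw [inv_mul_le_iff₀ ht']
      exact (hbound t ht).2
    · filter_upwards [ae_restrict_mem measurableSet_Ioi] with t ht
      have ht' : 0 < t := ht
      refine Tendsto.mul_const _ ?_
      have h1 : Tendsto (fun φ : ℝ => (φ⁻¹ + t)⁻¹) atTop (𝓝 (t⁻¹)) := by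
        have h2 : Tendsto (fun φ : ℝ => φ⁻¹ + t) atTop (𝓝 (0 + t)) :=
          tendsto_inv_atTop_zero.add_const t
        rw [zero_add] at h2
        exact h2.inv₀ ht'.ne'
      refine h1.congr' ?_
      filter_upwards [eventually_gt_atTop 0] with φ hφ
      field_simp
  refine hT.congr' ?_
  filter_upwards [eventually_gt_atTop 0] with φ hφ
  simp_rw [mul_sub]
  rw [integral_sub (integrableOn_laplace_kernel hφ one_pos) (integrableOn_laplace_kernel hφ hl0),
    integral_laplace_kernel hφ one_pos, integral_laplace_kernel hφ hl0]
  ring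

/-- As the coefficients sum to `-1` when `m ≠ 0`, adding the `l = 1` exponential integral once is
the same as subtracting it inside every term. -/
theorem tendsto_eiSum_add {m : ℕ} (hm : m ≠ 0) :
    Tendsto (fun φ : ℝ => eiSum m φ + Real.exp (1 / φ) * Ei (-(1 / φ))) atTop
      (𝓝 (∑ l ∈ Finset.Icc 1 m, (m.choose l : ℝ) * (-1) ^ l * Real.log l)) := by
  have h : ∀ φ : ℝ, eiSum m φ + Real.exp (1 / φ) * Ei (-(1 / φ))
      = ∑ l ∈ Finset.Icc 1 m, (m.choose l : ℝ) * (-1) ^ l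
        * (Real.exp (l / φ) * Ei (-(l / φ)) - Real.exp (1 / φ) * Ei (-(1 / φ))) := by
    intro φ
    have h1 := sum_Icc_choose_mul_pow m 1
    simp only [one_pow, mul_one, sub_self, zero_pow hm, zero_sub] at h1
    simp_rw [mul_sub, Finset.sum_sub_distrib, ← Finset.sum_mul, h1, eiSum]
    rw [neg_one_mul, sub_neg_eq_add]
    congr 1
    exact Finset.sum_congr rfl fun l _ => by ring
  simp_rw [h]
  refine tendsto_finsetSum _ fun l hl => (tendsto_exp_mul_Ei_sub ?_).const_mul _
  exact_mod_cast (Finset.mem_Icc.1 hl).1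

/-! ### Order statistics of a finite family -/

section OrderStatistics

variable {K : ℕ} {y : Fin K → ℝ} {σ : Equiv.Perm (Fin K)}

theorem first_eq_sup' (h : Antitone fun j => y (σ j)) (hK : 0 < K)
    (hne : (Finset.univ : Finset (Fin K)).Nonempty) :
    y (σ ⟨0, hK⟩) = Finset.univ.sup' hne y := by
  refine le_antisymm (Finset.le_sup' y (Finset.mem_univ _)) (Finset.sup'_le _ _ fun j _ => ?_)
  have := h (show (⟨0, hK⟩ : Fin K) ≤ σ.symm j from Nat.zero_le _)
  simpa using this

theorem last_eq_inf' (h : Antitone fun j => y (σ j)) (hK : K - 1 < K)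
    (hne : (Finset.univ : Finset (Fin K)).Nonempty) :
    y (σ ⟨K - 1, hK⟩) = Finset.univ.inf' hne y := by
  refine le_antisymm (Finset.le_inf' _ _ fun j _ => ?_) (Finset.inf'_le y (Finset.mem_univ _))
  have := h (show σ.symm j ≤ (⟨K - 1, hK⟩ : Fin K) from Nat.le_sub_one_of_lt (σ.symm j).isLt)
  simpa using this

theorem sup'_erase_eq (h : Antitone fun j => y (σ j)) (hK : 1 < K) (m : Fin K)
    (hne : (Finset.univ.erase (σ m)).Nonempty) :
    (Finset.univ.erase (σ m)).sup' hne y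
      = if m = ⟨0, by omega⟩ then y (σ ⟨1, hK⟩) else y (σ ⟨0, by omega⟩) := by
  split_ifs with hm
  · refine le_antisymm (Finset.sup'_le _ _ fun j hj => ?_) (Finset.le_sup' y ?_)
    · have h1 : (⟨1, hK⟩ : Fin K) ≤ σ.symm j := by
        have h2 : σ.symm j ≠ m := fun h' => (Finset.mem_erase.1 hj).1 (by rw [← h']; simp)
        rw [hm, Ne, Fin.ext_iff] at h2
        exact Nat.one_le_iff_ne_zero.2 h2
      simpa using h h1
    · rw [hm]
      simp [Fin.ext_iff]
  · refine le_antisymm (Finset.sup'_le _ _ fun j _ => ?_) (Finset.le_sup' y ?_)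
    · have := h (show (⟨0, by omega⟩ : Fin K) ≤ σ.symm j from Nat.zero_le _)
      simpa using this
    · simpa using Ne.symm hm

/-- Deleting the top index leaves the second largest value as maximum; each of the other `K - 1`
deletions leaves the maximum unchanged. This makes a separate tail computation for the second
largest value unnecessary, and ties do no harm. -/
theorem comp_second_eq (h : Antitone fun j => y (σ j)) (hK : 1 < K) (f : ℝ → ℝ)
    (hne : ∀ j : Fin K, (Finset.univ.erase j).Nonempty)
    (hne' : (Finset.univ : Finset (Fin K)).Nonempty) :
    f (y (σ ⟨1, hK⟩)) = ∑ j, f ((Finset.univ.erase j).sup' (hne j) y)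
      - (K - 1) * f (Finset.univ.sup' hne' y) := by
  rw [← Equiv.sum_comp σ, ← first_eq_sup' h (by omega) hne']
  simp_rw [fun m => sup'_erase_eq h hK m (hne (σ m)), apply_ite f]
  have h1 : ∀ m : Fin K, (if m = ⟨0, by omega⟩ then f (y (σ ⟨1, hK⟩))
        else f (y (σ ⟨0, by omega⟩)))
      = (if m = ⟨0, by omega⟩ then f (y (σ ⟨1, hK⟩)) - f (y (σ ⟨0, by omega⟩)) else 0)
        + f (y (σ ⟨0, by omega⟩)) := by
    intro m; split_ifs <;> ring
  simp_rw [h1, Finset.sum_add_distrib]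
  simp
  ring

end OrderStatistics

theorem integral_log_one_add_second {Ω : Type*} [MeasurableSpace Ω] {μ : Measure Ω} {K : ℕ}
    (hK : 1 < K) {Y : Fin K → Ω → ℝ} (hi : iIndepFun Y μ) (hm : ∀ j, AEMeasurable (Y j) μ)
    (h0 : ∀ j, 0 ≤ᵐ[μ] Y j)
    (hY : ∀ j, ∀ t, 0 ≤ t → μ {ω | t < Y j ω} = ENNReal.ofReal (Real.exp (-t)))
    {σ : Ω → Equiv.Perm (Fin K)} (hσ : ∀ ω, Antitone fun j => Y (σ ω j) ω) {φ : ℝ} (hφ : 0 < φ) :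
    Integrable (fun ω => Real.log (1 + φ * Y (σ ω ⟨1, hK⟩) ω)) μ ∧
      ∫ ω, Real.log (1 + φ * Y (σ ω ⟨1, hK⟩) ω) ∂μ
        = K * eiSum (K - 1) φ - (K - 1) * eiSum K φ := by
  have hne' : (Finset.univ : Finset (Fin K)).Nonempty := ⟨⟨0, by omega⟩, Finset.mem_univ _⟩
  have hcard : ∀ j : Fin K, (Finset.univ.erase j).card = K - 1 := fun j => by simp
  have hne : ∀ j : Fin K, (Finset.univ.erase j).Nonempty := fun j =>
    Finset.card_pos.1 (by rw [hcard j]; omega)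
  have h1 := integral_log_one_add_sup' hi hm h0 hY Finset.univ hne' hφ
  have h2 := fun j => integral_log_one_add_sup' hi hm h0 hY _ (hne j) hφ
  have h3 : (fun ω => Real.log (1 + φ * Y (σ ω ⟨1, hK⟩) ω)) = fun ω =>
      ∑ j, Real.log (1 + φ * (Finset.univ.erase j).sup' (hne j) fun j => Y j ω)
        - (K - 1) * Real.log (1 + φ * Finset.univ.sup' hne' fun j => Y j ω) :=
    funext fun ω => comp_second_eq (y := fun j => Y j ω) (hσ ω) hK (fun x => Real.log (1 + φ * x)) hne hne'
  have h4 := integrable_finsetSum Finset.univ fun j _ => (h2 j).1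
  rw [h3]
  refine ⟨h4.sub (h1.1.const_mul _), ?_⟩
  rw [integral_sub h4 (h1.1.const_mul _), integral_finsetSum _ fun j _ => (h2 j).1,
    integral_const_mul, h1.2]
  simp_rw [fun j => (h2 j).2, hcard]
  simp

/-! ### The sum-rate gap, its mean and its limit -/

/-- With gain `x`, `a² + b² = 1` gives `1 + SNR = (1 + ρx) / (1 + ρa²x)`. -/
theorem logb_one_add_snrWeak {M N r : ℕ} {i : Fin M} {H : Matrix (Fin N) (Fin M) ℂ}
    {U : Matrix (Fin N) (Fin r) ℂ} (hU : Uᴴ * U = 1) {ρ a b : ℝ} (hρ : 0 < ρ)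
    (hab : a ^ 2 + b ^ 2 = 1) :
    Real.logb 2 (1 + snrWeak ρ a b i H U)
      = (Real.log (1 + ρ * gain i H U) - Real.log (1 + ρ * a ^ 2 * gain i H U)) / Real.log 2 := by
  have hg := gain_nonneg i H U
  rw [snrWeak_eq hU, Real.logb, ← Real.log_div (by positivity) (by positivity)]
  congr 2
  field_simp
  linear_combination (ρ * gain i H U + ρ ^ 2 * a ^ 2 * gain i H U ^ 2) * hab

theorem sumRateGap_eq {M K N r : ℕ} {ρ a b : ℝ} (hρ : 0 < ρ) (hab : a ^ 2 + b ^ 2 = 1)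
    (n k : Fin K) {H : Fin M → Fin K → Matrix (Fin N) (Fin M) ℂ}
    {U : Fin M → Fin K → Matrix (Fin N) (Fin r) ℂ} (hU : ∀ i j, (U i j)ᴴ * U i j = 1) :
    sumRateGap ρ a b n k H U = ∑ i, (1 / (2 * Real.log 2))
      * (Real.log (1 + ρ * gain i (H i k) (U i k))
        - 2 * Real.log (1 + ρ * a ^ 2 * gain i (H i k) (U i k))
        + 2 * Real.log (1 + ρ * a ^ 2 * gain i (H i n) (U i n))
        - Real.log (1 + ρ * gain i (H i n) (U i n))) := by
  rw [sumRateGap, Finset.mul_sum, ← Finset.sum_sub_distrib]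
  refine Finset.sum_congr rfl fun i _ => ?_
  rw [logb_one_add_snrWeak (hU i k) hρ hab, snrStrong_eq (hU i n)]
  simp only [Real.logb]
  have : Real.log 2 ≠ 0 := (Real.log_pos one_lt_two).ne'
  field_simp
  ring

/-- Linearity of the integral alone, so no independence between users or clusters enters. The two
clusters contribute equally, which cancels the factor `1/2`. -/
theorem integral_sumRateGap {Ω : Type*} [MeasurableSpace Ω] {μ : Measure Ω} {K N r : ℕ}
    {ρ a b : ℝ} (hρ : 0 < ρ) (ha : 0 < a) (hab : a ^ 2 + b ^ 2 = 1) (n k : Fin K)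
    {H : Fin 2 → Fin K → Ω → Matrix (Fin N) (Fin 2) ℂ}
    {U : Fin 2 → Fin K → Ω → Matrix (Fin N) (Fin r) ℂ} (hU : ∀ i j ω, (U i j ω)ᴴ * U i j ω = 1)
    {A B : ℝ → ℝ}
    (hA : ∀ i, ∀ φ > 0, Integrable (fun ω => Real.log (1 + φ * gain i (H i k ω) (U i k ω))) μ ∧
      ∫ ω, Real.log (1 + φ * gain i (H i k ω) (U i k ω)) ∂μ = A φ)
    (hB : ∀ i, ∀ φ > 0, Integrable (fun ω => Real.log (1 + φ * gain i (H i n ω) (U i n ω))) μ ∧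
      ∫ ω, Real.log (1 + φ * gain i (H i n ω) (U i n ω)) ∂μ = B φ) :
    Integrable (fun ω => sumRateGap ρ a b n k (fun i j => H i j ω) fun i j => U i j ω) μ ∧
      ∫ ω, sumRateGap ρ a b n k (fun i j => H i j ω) (fun i j => U i j ω) ∂μ
        = (A ρ - 2 * A (ρ * a ^ 2) + 2 * B (ρ * a ^ 2) - B ρ) / Real.log 2 := by
  have hρa : 0 < ρ * a ^ 2 := by positivity
  simp_rw [fun ω => sumRateGap_eq hρ hab n k (H := fun i j => H i j ω) (U := fun i j => U i j ω)
    fun i j => hU i j ω]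
  have i1 := fun i => (hA i ρ hρ).1.sub ((hA i _ hρa).1.const_mul 2)
  have i2 := fun i => (i1 i).add ((hB i _ hρa).1.const_mul 2)
  have i3 := fun i => ((i2 i).sub (hB i ρ hρ).1).const_mul (1 / (2 * Real.log 2))
  refine ⟨integrable_finsetSum _ fun i _ => i3 i, ?_⟩
  have h4 : ∀ i, ∫ ω, (1 / (2 * Real.log 2))
      * (Real.log (1 + ρ * gain i (H i k ω) (U i k ω))
        - 2 * Real.log (1 + ρ * a ^ 2 * gain i (H i k ω) (U i k ω))
        + 2 * Real.log (1 + ρ * a ^ 2 * gain i (H i n ω) (U i n ω))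
        - Real.log (1 + ρ * gain i (H i n ω) (U i n ω))) ∂μ
      = (1 / (2 * Real.log 2)) * (A ρ - 2 * A (ρ * a ^ 2) + 2 * B (ρ * a ^ 2) - B ρ) := by
    intro i
    rw [integral_const_mul]
    congr 1
    refine (integral_sub (i2 i) (hB i ρ hρ).1).trans ?_
    rw [(hB i ρ hρ).2]
    congr 1
    refine (integral_add (i1 i) ((hB i _ hρa).1.const_mul 2)).trans ?_
    rw [integral_const_mul, (hB i _ hρa).2]
    congr 1
    refine (integral_sub (hA i ρ hρ).1 ((hA i _ hρa).1.const_mul 2)).trans ?_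
    rw [integral_const_mul, (hA i _ hρa).2, (hA i ρ hρ).2]
  refine (integral_finsetSum _ fun i _ => i3 i).trans ((Finset.sum_congr rfl fun i _ => h4 i).trans ?_)
  rw [Fin.sum_univ_two]
  have : Real.log 2 ≠ 0 := (Real.log_pos one_lt_two).ne'
  field_simp
  ring

/-- `T` compensates the common divergence of `A` and `B` and drops out of `A - B`, which tends to `x
- y`. Evaluating at `ρ` and, with weight `-2`, at `ρa²` gives `(x - y) - 2 (x - y)`. -/
theorem tendsto_gap {A B T : ℝ → ℝ} {x y a : ℝ} (ha : 0 < a)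
    (hA : Tendsto (fun φ => A φ + T φ) atTop (𝓝 x))
    (hB : Tendsto (fun φ => B φ + T φ) atTop (𝓝 y)) (c : ℝ) :
    Tendsto (fun ρ => (A ρ - 2 * A (ρ * a ^ 2) + 2 * B (ρ * a ^ 2) - B ρ) / c) atTop
      (𝓝 ((y - x) / c)) := by
  have hs : Tendsto (fun ρ : ℝ => ρ * a ^ 2) atTop atTop :=
    tendsto_id.atTop_mul_const (by positivity)
  have h1 := hA.sub hB
  have h2 := ((h1.comp hs).const_mul 2)
  convert! (h1.sub h2).div_const c using 2
  · simp only [Function.comp_apply]; ring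
  · ring

end MimoNoma

/-! ### The main theorem -/

theorem lemma2 {Ω : Type*} [MeasurableSpace Ω] (μ : Measure Ω) [IsProbabilityMeasure μ]
    (K : ℕ) (hK : 2 ≤ K)
    -- channel matrices of the users before ordering, for `M = N = 2`
    (G : Fin 2 → Fin K → Ω → Matrix (Fin 2) (Fin 2) ℂ) (hG : MimoNoma.IsRayleigh G μ)
    (U : Fin 2 → Fin K → Ω → Matrix (Fin 2) (Fin (2 - 2 + 1)) ℂ)
    (hU : ∀ i j ω, MimoNoma.IsNullBasis i (G i j ω) (U i j ω))
    -- `σ i ω j` is the user of cluster `i` with the `j`-th largest effective channel gain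
    (σ : Fin 2 → Ω → Equiv.Perm (Fin K))
    (hσ : ∀ i ω, Antitone fun j => MimoNoma.gain i (G i (σ i ω j) ω) (U i (σ i ω j) ω))
    -- power allocation coefficients of the stronger and the weaker user of each pair
    (α β : ℝ) (hα : 0 < α) (hαβ : α ^ 2 + β ^ 2 = 1)
    -- the gap when the best user is paired with the `k`-th ordered user
    (Δ : Fin K → ℝ → Ω → ℝ)
    (hΔ : ∀ k ρ ω, Δ k ρ ω = MimoNoma.sumRateGap ρ α β ⟨0, by omega⟩ k
      (fun i j => G i (σ i ω j) ω) (fun i j => U i (σ i ω j) ω)) :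
    -- Case I: the best and the worst user
    ((∀ ρ : ℝ, 0 < ρ → Integrable (Δ ⟨K - 1, by omega⟩ ρ) μ ∧
        ∫ ω, Δ ⟨K - 1, by omega⟩ ρ ω ∂μ =
          - Real.logb 2 (Real.exp 1) * Real.exp (K / ρ) * MimoNoma.Ei (-(K / ρ))
          + 2 / Real.log 2 * (∑ l ∈ Finset.Icc 1 K, (K.choose l : ℝ) * (-1) ^ l
              * Real.exp (l / (ρ * α ^ 2)) * MimoNoma.Ei (-(l / (ρ * α ^ 2))))
          + 2 * Real.logb 2 (Real.exp 1) * Real.exp (K / (ρ * α ^ 2))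
              * MimoNoma.Ei (-(K / (ρ * α ^ 2)))
          - 1 / Real.log 2 * (∑ l ∈ Finset.Icc 1 K, (K.choose l : ℝ) * (-1) ^ l
              * Real.exp (l / ρ) * MimoNoma.Ei (-(l / ρ)))) ∧
      Tendsto (fun ρ : ℝ => ∫ ω, Δ ⟨K - 1, by omega⟩ ρ ω ∂μ) atTop
        (𝓝 (Real.logb 2 K
          + ∑ l ∈ Finset.Icc 1 K, (K.choose l : ℝ) * (-1) ^ l * Real.logb 2 l))) ∧
    -- Case II: the best and the second best user
    ((∀ ρ : ℝ, 0 < ρ → Integrable (Δ ⟨1, by omega⟩ ρ) μ ∧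
        ∫ ω, Δ ⟨1, by omega⟩ ρ ω ∂μ =
          1 / Real.log 2 * (K * (∑ p ∈ Finset.Icc 1 (K - 1), ((K - 1).choose p : ℝ) * (-1) ^ p
                * Real.exp (p / ρ) * MimoNoma.Ei (-(p / ρ)))
              - (K - 1) * (∑ l ∈ Finset.Icc 1 K, (K.choose l : ℝ) * (-1) ^ l
                * Real.exp (l / ρ) * MimoNoma.Ei (-(l / ρ))))
          + 2 / Real.log 2 * (∑ l ∈ Finset.Icc 1 K, (K.choose l : ℝ) * (-1) ^ l
              * Real.exp (l / (ρ * α ^ 2)) * MimoNoma.Ei (-(l / (ρ * α ^ 2))))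
          - 2 / Real.log 2 * (K * (∑ p ∈ Finset.Icc 1 (K - 1), ((K - 1).choose p : ℝ) * (-1) ^ p
                * Real.exp (p / (ρ * α ^ 2)) * MimoNoma.Ei (-(p / (ρ * α ^ 2))))
              - (K - 1) * (∑ l ∈ Finset.Icc 1 K, (K.choose l : ℝ) * (-1) ^ l
                * Real.exp (l / (ρ * α ^ 2)) * MimoNoma.Ei (-(l / (ρ * α ^ 2)))))
          - 1 / Real.log 2 * (∑ l ∈ Finset.Icc 1 K, (K.choose l : ℝ) * (-1) ^ l
              * Real.exp (l / ρ) * MimoNoma.Ei (-(l / ρ)))) ∧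
      Tendsto (fun ρ : ℝ => ∫ ω, Δ ⟨1, by omega⟩ ρ ω ∂μ) atTop
        (𝓝 (K * (-(∑ p ∈ Finset.Icc 1 (K - 1), ((K - 1).choose p : ℝ) * (-1) ^ p * Real.logb 2 p)
          + ∑ l ∈ Finset.Icc 1 K, (K.choose l : ℝ) * (-1) ^ l * Real.logb 2 l)))) := by

  have hK0 : 0 < K := by omega
  have hne : (Finset.univ : Finset (Fin K)).Nonempty := ⟨⟨0, hK0⟩, Finset.mem_univ _⟩
  have hcard : (Finset.univ : Finset (Fin K)).card = K := by simp
  have hUσ : ∀ i (j : Fin K) ω, (U i (σ i ω j) ω)ᴴ * U i (σ i ω j) ω = 1 := fun i j ω =>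
    (hU i (σ i ω j) ω).1
  -- `U` is an arbitrary choice of null vectors, not assumed measurable in `ω`. Measurability,
  -- independence and tails of the gains are therefore transferred from the determinant ratio by
  -- almost everywhere equality.
  have hae := MimoNoma.ae_gain_eq_detRatio hG hU
  have hind : ∀ i, iIndepFun (fun j ω => MimoNoma.gain i (G i j ω) (U i j ω)) μ := fun i =>
    (iIndepFun_congr (hae i)).2 (MimoNoma.iIndepFun_detRatio hG i)
  have hmeas : ∀ i j, AEMeasurable (fun ω => MimoNoma.gain i (G i j ω) (U i j ω)) μ := fun i j =>
    (MimoNoma.aemeasurable_detRatio hG i j).congr (hae i j).symm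
  have hnn : ∀ i j, 0 ≤ᵐ[μ] fun ω => MimoNoma.gain i (G i j ω) (U i j ω) := fun i j =>
    Eventually.of_forall fun ω => MimoNoma.gain_nonneg _ _ _
  have htail : ∀ i j, ∀ t, 0 ≤ t → μ {ω | t < MimoNoma.gain i (G i j ω) (U i j ω)}
      = ENNReal.ofReal (Real.exp (-t)) := by
    intro i j t ht
    rw [← MimoNoma.measure_detRatio_gt hG i j ht]
    refine measure_congr ?_
    filter_upwards [hae i j] with ω hω
    exact congrArg (fun x => t < x) hω
  have hmax : ∀ i, ∀ φ > 0, Integrable (fun ω => Real.log (1 + φ * MimoNoma.gain i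
        (G i (σ i ω ⟨0, hK0⟩) ω) (U i (σ i ω ⟨0, hK0⟩) ω))) μ ∧
      ∫ ω, Real.log (1 + φ * MimoNoma.gain i (G i (σ i ω ⟨0, hK0⟩) ω)
        (U i (σ i ω ⟨0, hK0⟩) ω)) ∂μ = MimoNoma.eiSum K φ := by
    intro i φ hφ
    have h := MimoNoma.integral_log_one_add_sup' (hind i) (hmeas i) (hnn i) (htail i)
      Finset.univ hne hφ
    have he : ∀ ω, MimoNoma.gain i (G i (σ i ω ⟨0, hK0⟩) ω) (U i (σ i ω ⟨0, hK0⟩) ω)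
        = Finset.univ.sup' hne fun j => MimoNoma.gain i (G i j ω) (U i j ω) := fun ω =>
      MimoNoma.first_eq_sup' (y := fun j => MimoNoma.gain i (G i j ω) (U i j ω)) (hσ i ω) hK0 hne
    simp_rw [he]
    rwa [hcard] at h
  have hmin : ∀ i, ∀ φ > 0, Integrable (fun ω => Real.log (1 + φ * MimoNoma.gain i
        (G i (σ i ω ⟨K - 1, by omega⟩) ω) (U i (σ i ω ⟨K - 1, by omega⟩) ω))) μ ∧
      ∫ ω, Real.log (1 + φ * MimoNoma.gain i (G i (σ i ω ⟨K - 1, by omega⟩) ω)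
        (U i (σ i ω ⟨K - 1, by omega⟩) ω)) ∂μ
        = -(Real.exp (K / φ) * MimoNoma.Ei (-(K / φ))) := by
    intro i φ hφ
    have h := MimoNoma.integral_log_one_add_inf' (hind i) (hmeas i) (hnn i) (htail i)
      Finset.univ hne hφ
    have he : ∀ ω, MimoNoma.gain i (G i (σ i ω ⟨K - 1, by omega⟩) ω) (U i (σ i ω ⟨K - 1, by omega⟩) ω)
        = Finset.univ.inf' hne fun j => MimoNoma.gain i (G i j ω) (U i j ω) := fun ω =>
      MimoNoma.last_eq_inf' (y := fun j => MimoNoma.gain i (G i j ω) (U i j ω)) (hσ i ω) (by omega) hne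
    simp_rw [he]
    rwa [hcard] at h
  have hsnd := fun i φ (hφ : φ > 0) => MimoNoma.integral_log_one_add_second (by omega) (hind i)
    (hmeas i) (hnn i) (htail i) (hσ i) hφ
  have hlast := fun ρ (hρ : 0 < ρ) => MimoNoma.integral_sumRateGap hρ hα hαβ ⟨0, hK0⟩
    ⟨K - 1, by omega⟩ (H := fun i j ω => G i (σ i ω j) ω) hUσ hmin hmax
  have hsecond := fun ρ (hρ : 0 < ρ) => MimoNoma.integral_sumRateGap hρ hα hαβ ⟨0, hK0⟩
    ⟨1, by omega⟩ (H := fun i j ω => G i (σ i ω j) ω) hUσ hsnd hmax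
  have hΔ' : ∀ k ρ, Δ k ρ = fun ω => MimoNoma.sumRateGap ρ α β ⟨0, hK0⟩ k
      (fun i j => G i (σ i ω j) ω) (fun i j => U i (σ i ω j) ω) := fun k ρ => funext (hΔ k ρ)
  have hL := MimoNoma.tendsto_eiSum_add (m := K) (by omega)
  have hL' := MimoNoma.tendsto_eiSum_add (m := K - 1) (by omega)
  simp_rw [hΔ']
  refine ⟨⟨fun ρ hρ => ⟨(hlast ρ hρ).1, ?_⟩, ?_⟩, ⟨fun ρ hρ => ⟨(hsecond ρ hρ).1, ?_⟩, ?_⟩⟩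
  · rw [(hlast ρ hρ).2, Real.logb, Real.log_exp]
    simp only [MimoNoma.eiSum]
    ring
  · have hA : Tendsto (fun φ : ℝ => -(Real.exp (K / φ) * MimoNoma.Ei (-(K / φ)))
        + Real.exp (1 / φ) * MimoNoma.Ei (-(1 / φ))) atTop (𝓝 (-Real.log K)) := by
      have h := (MimoNoma.tendsto_exp_mul_Ei_sub (l := K) (by exact_mod_cast hK0)).neg
      simpa [neg_add_eq_sub] using h
    have h := MimoNoma.tendsto_gap hα hA hL (Real.log 2)
    have hlim : (∑ l ∈ Finset.Icc 1 K, (K.choose l : ℝ) * (-1) ^ l * Real.log l - -Real.log K)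
        / Real.log 2 = Real.logb 2 K
          + ∑ l ∈ Finset.Icc 1 K, (K.choose l : ℝ) * (-1) ^ l * Real.logb 2 l := by
      simp_rw [Real.logb, ← mul_div_assoc, ← Finset.sum_div]
      ring
    rw [← hlim]
    refine h.congr' ?_
    filter_upwards [eventually_gt_atTop 0] with ρ hρ
    exact (hlast ρ hρ).2.symm
  · rw [(hsecond ρ hρ).2]
    simp only [MimoNoma.eiSum]
    ring
  -- The weights satisfy `K - (K - 1) = 1`, so the compensating term is needed exactly once here
  -- too.
  · have hA : Tendsto (fun φ : ℝ => (K * MimoNoma.eiSum (K - 1) φ - (K - 1) * MimoNoma.eiSum K φ)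
        + Real.exp (1 / φ) * MimoNoma.Ei (-(1 / φ))) atTop _ :=
      ((hL'.const_mul (K : ℝ)).sub (hL.const_mul ((K : ℝ) - 1))).congr fun φ => by ring
    have h := MimoNoma.tendsto_gap hα hA hL (Real.log 2)
    have hlim : (∑ l ∈ Finset.Icc 1 K, (K.choose l : ℝ) * (-1) ^ l * Real.log l
        - (K * ∑ l ∈ Finset.Icc 1 (K - 1), ((K - 1).choose l : ℝ) * (-1) ^ l * Real.log l
          - (K - 1) * ∑ l ∈ Finset.Icc 1 K, (K.choose l : ℝ) * (-1) ^ l * Real.log l))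
        / Real.log 2
        = K * (-(∑ p ∈ Finset.Icc 1 (K - 1), ((K - 1).choose p : ℝ) * (-1) ^ p * Real.logb 2 p)
          + ∑ l ∈ Finset.Icc 1 K, (K.choose l : ℝ) * (-1) ^ l * Real.logb 2 l) := by
      simp_rw [Real.logb, ← mul_div_assoc, ← Finset.sum_div]
      ring
    rw [← hlim]
    refine h.congr' ?_
    filter_upwards [eventually_gt_atTop 0] with ρ hρ
    exact (hsecond ρ hρ).2.symm
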